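/- Let $d\in\mathbb N$. A signed Radon measure $\mu$ on $\mathbb R^d$ is a difference of two mutually singular locally finite positive Borel measures; for bounded Borel $f$ with bounded support write $\mu(f)=\int f\,d\mu$, and equip the space $M(\mathbb R^d)$ of signed Radon measures with the smallest $\sigma$-algebra making all maps $\mu\mapsto\mu(f)$ measurable. Let $\mathbb R^d$ act by measure-preserving transformations on a probability space $(\Omega,\mathbb P)$ and let $p:\Omega\to M(\mathbb R^d)$, $\omega\mapsto p_\omega$, be an invariant random measure, i.e. a measurable map that is equivariant with respect to translations (for instance an invariant point process). Assume that $p$ is locally square-integrable: $\mathbb E[p_\omega(B)^2]<\infty$ for every bounded Borel set $B$. The centered autocorrelation of $p$ is the unique signed Radon measure $\eta_p$ with $\eta_p(f*f^*)=\mathrm{Var}(p_\omega(f))$ for all bounded complex Borel functions $f$ with bounded support, where $f^*(x)=\overline{f(-x)}$, and the centered diffraction $\widehat\eta_p$ is its Fourier transform, i.e. the unique positive Radon measure on $\mathbb R^d$ with $\int|\widehat f|^2\,d\widehat\eta_p=\eta_p(f*f^*)$ for all $f\in C_c(\mathbb R^d)$, where $\widehat f(\xi)=\int f(x)e^{-2\pi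 i\langle x,\xi\rangle}\,dx$. Let $B_r$ be the Euclidean ball of radius $r$ around $0$. **Lemma.** Suppose that there are $\delta>0$, $C>0$ and a sequence $\varepsilon_n>0$ with $\varepsilon_n\to0$ such that $$\widehat\eta_p(B_{\varepsilon_n})\le C\,\varepsilon_n^{2d+\delta}\qquad\text{for all }n.$$ Then $p$ is number rigid: for every bounded Borel set $B\subset\mathbb R^d$ there is a conull set $\Omega_B\subset\Omega$ such that for all $\omega,\omega'\in\Omega_B$ with $p_\omega|_{B^c}=p_{\omega'}|_{B^c}$ one has $p_\omega(B)=p_{\omega'}(B)$. -/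

import Mathlib

open MeasureTheory Filter Topology
open scoped FourierTransform ENNReal

noncomputable section

/-- The space `ℒ_c^∞(ℝ^d)`: bounded complex-valued Borel functions that vanish outside a
compact set. -/
def IsBoundedCompactlySupported {d : ℕ} (f : EuclideanSpace ℝ (Fin d) → ℂ) : Prop :=
  Measurable f ∧ (∃ C : ℝ, ∀ x, ‖f x‖ ≤ C) ∧ HasCompactSupport f

/-- A signed Radon measure on `ℝ^d`, given by its Jordan decomposition: a pair of mutually
singular locally finite Borel measures. Both parts may have infinite total mass, so that such an
object is a set function on bounded Borel sets only. -/
@[ext]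
structure SignedRadonMeasure (d : ℕ) where
  pos : Measure (EuclideanSpace ℝ (Fin d))
  neg : Measure (EuclideanSpace ℝ (Fin d))
  pos_locallyFinite : IsLocallyFiniteMeasure pos
  neg_locallyFinite : IsLocallyFiniteMeasure neg
  mutuallySingular : pos ⟂ₘ neg

namespace SignedRadonMeasure

/-- The integral of `f` against a signed Radon measure. -/
def integral {d : ℕ} {F : Type*} [NormedAddCommGroup F] [NormedSpace ℝ F]
    (μ : SignedRadonMeasure d) (f : EuclideanSpace ℝ (Fin d) → F) : F :=
  ∫ x, f x ∂μ.pos - ∫ x, f x ∂μ.neg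

/-- The value `μ(B)` on a bounded Borel set `B`. -/
def value {d : ℕ} (μ : SignedRadonMeasure d) (B : Set (EuclideanSpace ℝ (Fin d))) : ℝ :=
  μ.pos.real B - μ.neg.real B

/-- The restriction `μ|_A` to a Borel set `A`. -/
def restrict {d : ℕ} (μ : SignedRadonMeasure d) (A : Set (EuclideanSpace ℝ (Fin d))) :
    SignedRadonMeasure d where
  pos := μ.pos.restrict A
  neg := μ.neg.restrict A
  pos_locallyFinite := by
    have := μ.pos_locallyFinite
    infer_instance
  neg_locallyFinite := by
    have := μ.neg_locallyFinite
    infer_instance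
  mutuallySingular :=
    μ.mutuallySingular.mono_ac Measure.restrict_le_self.absolutelyContinuous
      Measure.restrict_le_self.absolutelyContinuous

/-- The image of `μ` under the translation `x ↦ g + x`. -/
def translate {d : ℕ} (g : EuclideanSpace ℝ (Fin d)) (μ : SignedRadonMeasure d) :
    SignedRadonMeasure d where
  pos := μ.pos.map (fun x => g + x)
  neg := μ.neg.map (fun x => g + x)
  pos_locallyFinite := by
    have := μ.pos_locallyFinite
    have : IsFiniteMeasureOnCompacts (μ.pos.map (fun x => g + x)) :=
      Measure.IsFiniteMeasureOnCompacts.map μ.pos (Homeomorph.addLeft g)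
    infer_instance
  neg_locallyFinite := by
    have := μ.neg_locallyFinite
    have : IsFiniteMeasureOnCompacts (μ.neg.map (fun x => g + x)) :=
      Measure.IsFiniteMeasureOnCompacts.map μ.neg (Homeomorph.addLeft g)
    infer_instance
  mutuallySingular := by
    obtain ⟨s, hs, h1, h2⟩ := μ.mutuallySingular
    have hm : Measurable (fun x : EuclideanSpace ℝ (Fin d) => g + x) := measurable_const_add g
    have hs' : MeasurableSet ((fun x => -g + x) ⁻¹' s) := measurable_const_add (-g) hs
    refine ⟨(fun x => -g + x) ⁻¹' s, hs', ?_, ?_⟩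
    · rw [Measure.map_apply hm hs']
      simpa [Set.preimage_preimage] using h1
    · rw [Measure.map_apply hm hs'.compl]
      simpa [Set.preimage_preimage, ← Set.preimage_compl] using h2

/-- The smallest `σ`-algebra on the space of signed Radon measures for which all linear statistics
`μ ↦ μ(f)`, with `f` in `ℒ_c^∞(ℝ^d)`, are measurable. -/
instance instMeasurableSpace {d : ℕ} : MeasurableSpace (SignedRadonMeasure d) :=
  ⨆ f : {f : EuclideanSpace ℝ (Fin d) → ℂ // IsBoundedCompactlySupported f},
    MeasurableSpace.comap (fun μ : SignedRadonMeasure d => μ.integral f.1) inferInstance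

end SignedRadonMeasure

/-- `p` is an invariant random measure on `ℝ^d`, defined on the probability space `(Ω, P)` on which
`ℝ^d` acts by measure-preserving transformations: `p` is measurable and equivariant. -/
structure IsInvariantRandomMeasure {d : ℕ} {Ω : Type*} [MeasurableSpace Ω]
    [AddAction (EuclideanSpace ℝ (Fin d)) Ω] (P : Measure Ω) (p : Ω → SignedRadonMeasure d) :
    Prop where
  measurePreserving : ∀ g : EuclideanSpace ℝ (Fin d), MeasurePreserving (fun ω : Ω => g +ᵥ ω) P P
  measurable : Measurable p
  equivariant : ∀ (g : EuclideanSpace ℝ (Fin d)) (ω : Ω), p (g +ᵥ ω) = (p ω).translate g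

/-- `E[p(B)²] < ∞` for every bounded Borel set `B`. -/
def IsLocallySquareIntegrable {d : ℕ} {Ω : Type*} [MeasurableSpace Ω] (P : Measure Ω)
    (p : Ω → SignedRadonMeasure d) : Prop :=
  ∀ B : Set (EuclideanSpace ℝ (Fin d)), Bornology.IsBounded B → MeasurableSet B →
    Integrable (fun ω => ((p ω).value B) ^ 2) P

/-- The variance `E[|p(f) - E[p(f)]|²]` of the linear statistic of `f`. -/
def linearStatisticVariance {d : ℕ} {Ω : Type*} [MeasurableSpace Ω] (P : Measure Ω)
    (p : Ω → SignedRadonMeasure d) (f : EuclideanSpace ℝ (Fin d) → ℂ) : ℝ :=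
  ∫ ω, ‖(p ω).integral f - ∫ ω', (p ω').integral f ∂P‖ ^ 2 ∂P

/-- The convolution `f * f^*`, where `f^*(x)` is the complex conjugate of `f(-x)`. -/
def convStar {d : ℕ} (f : EuclideanSpace ℝ (Fin d) → ℂ) : EuclideanSpace ℝ (Fin d) → ℂ :=
  MeasureTheory.convolution f (fun x => star (f (-x))) (ContinuousLinearMap.mul ℝ ℂ) volume

/-- `η` is the centered autocorrelation of `p`: the (unique) signed Radon measure such that
`η(f * f^*) = Var(p(f))` for all `f` in `ℒ_c^∞(ℝ^d)`. The variances are required to be finite,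
so that the equation is one between genuine values. -/
def IsCenteredAutocorrelation {d : ℕ} {Ω : Type*} [MeasurableSpace Ω] (P : Measure Ω)
    (p : Ω → SignedRadonMeasure d) (η : SignedRadonMeasure d) : Prop :=
  ∀ f : EuclideanSpace ℝ (Fin d) → ℂ, IsBoundedCompactlySupported f →
    MemLp (fun ω => (p ω).integral f) 2 P ∧
      η.integral (convStar f) = (linearStatisticVariance P p f : ℂ)

/-- `ν` is the Fourier transform of the positive-definite signed Radon measure `η`: the (unique)
positive Radon measure such that `ν(|f̂|²) = η(f * f^*)` for all continuous compactly supported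
functions `f`, where `f̂(ξ) = ∫ f(x) exp(-2πi⟨x, ξ⟩) dx`. -/
def IsFourierTransformOf {d : ℕ} (η : SignedRadonMeasure d)
    (ν : Measure (EuclideanSpace ℝ (Fin d))) : Prop :=
  IsLocallyFiniteMeasure ν ∧
    ∀ f : EuclideanSpace ℝ (Fin d) → ℂ, Continuous f → HasCompactSupport f →
      Integrable (fun ξ => ‖𝓕 f ξ‖ ^ 2) ν ∧
        ((∫ ξ, ‖𝓕 f ξ‖ ^ 2 ∂ν : ℝ) : ℂ) = η.integral (convStar f)

/-- `ν` is the centered diffraction of `p`: the Fourier transform of its centered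
autocorrelation. -/
def IsCenteredDiffraction {d : ℕ} {Ω : Type*} [MeasurableSpace Ω] (P : Measure Ω)
    (p : Ω → SignedRadonMeasure d) (ν : Measure (EuclideanSpace ℝ (Fin d))) : Prop :=
  ∃ η : SignedRadonMeasure d, IsCenteredAutocorrelation P p η ∧ IsFourierTransformOf η ν

/-- `f` is a rigidity statistic for `p`: for every bounded Borel set `B` there is a conull set of
`ω` on which the integral of `f` over `B` against `p_ω` only depends on the restriction of `p_ω` to
the complement of `B`. -/
def IsRigidityStatistic {d : ℕ} {Ω : Type*} [MeasurableSpace Ω] (P : Measure Ω)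
    (p : Ω → SignedRadonMeasure d) (f : EuclideanSpace ℝ (Fin d) → ℝ) : Prop :=
  ∀ B : Set (EuclideanSpace ℝ (Fin d)), Bornology.IsBounded B → MeasurableSet B →
    ∃ S : Set Ω, P Sᶜ = 0 ∧ ∀ ω ∈ S, ∀ ω' ∈ S,
      (p ω).restrict Bᶜ = (p ω').restrict Bᶜ →
        ((p ω).restrict B).integral f = ((p ω').restrict B).integral f

/-- `p` is number rigid: the constant function `1` is a rigidity statistic, that is, `p_ω(B)` is
almost surely determined by the restriction of `p_ω` to the complement of `B`. -/
def IsNumberRigid {d : ℕ} {Ω : Type*} [MeasurableSpace Ω] (P : Measure Ω)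
    (p : Ω → SignedRadonMeasure d) : Prop :=
  IsRigidityStatistic P p (fun _ => 1)

end

/-! By the diffraction identity, the variance of `p(f)` is the integral of `‖𝓕 f‖ ^ 2` against `ν`.
It therefore suffices to find cutoffs `f n`, eventually equal to `1` on each ball, whose Fourier
transforms tend to zero in `L²(ν)`. Along a subsequence the centered statistics then vanish almost
surely. If two good configurations agree off `B`, their statistics differ by exactly the difference
of their masses on `B`, which must be zero.

The cutoffs are `g * φ(r ·)` with `r = ε ^ (1 + γ)`, slightly smaller than `ε`. Their transforms
have size at most of order `r⁻ᵈ`, so the ball of radius `ε` contributes at most of order `r⁻²ᵈ ε ^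
(2d + δ)`, which is small for small `γ`. Outside it, the rapid decay of `𝓕 φ` gains `(r / ε) ^ N = ε
^ (γ N)`, which beats `r⁻ᵈ` for large `N`. Smoothing by the fixed `g` leaves a factor `𝓕 g` in
`L²(ν)`, so no growth bound on `ν` at infinity is needed (`exists_cutoff`,
`exists_cutoff_seq_tendsto`). -/

/-- The Fourier transform of a dilated function. -/
theorem fourier_comp_smul_eq {d : ℕ} (g : EuclideanSpace ℝ (Fin d) → ℂ) {r : ℝ} (hr : 0 < r)
    (ξ : EuclideanSpace ℝ (Fin d)) :
    𝓕 (fun x => g (r • x)) ξ = ((r ^ d)⁻¹ : ℝ) • 𝓕 g (r⁻¹ • ξ) := by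
  have h := Measure.integral_comp_smul (volume : Measure (EuclideanSpace ℝ (Fin d)))
    (fun x => Real.fourierChar (-inner ℝ x (r⁻¹ • ξ)) • g x) r
  rw [finrank_euclideanSpace_fin, abs_of_pos (by positivity)] at h
  rw [Real.fourier_eq, Real.fourier_eq, ← h]
  congr 1
  ext x
  rw [inner_smul_left, inner_smul_right]
  simp [hr.ne']

/-- The Fourier transform of a smooth compactly supported function decays rapidly. -/
theorem exists_norm_pow_mul_fourier_le {d : ℕ} {g : EuclideanSpace ℝ (Fin d) → ℂ}
    (hg : HasCompactSupport g) (hg' : ContDiff ℝ (⊤ : ℕ∞) g) (N : ℕ) :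
    ∃ K : ℝ, 0 < K ∧ ∀ ξ, ‖ξ‖ ^ N * ‖𝓕 g ξ‖ ≤ K := by
  obtain ⟨K, hK, h⟩ := (𝓕 (hg.toSchwartzMap hg')).decay N 0
  refine ⟨K, hK, fun ξ => ?_⟩
  have := h ξ
  rwa [norm_iteratedFDeriv_zero, SchwartzMap.fourier_coe] at this

/-! ### Cutoff functions with concentrated Fourier transform -/

/-- The dilated convolution `x ↦ ∫ g(t) φ(r(x - t)) dt`. -/
noncomputable def dilatedConvolution {d : ℕ} (g φ : EuclideanSpace ℝ (Fin d) → ℂ) (r : ℝ) :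
    EuclideanSpace ℝ (Fin d) → ℂ :=
  MeasureTheory.convolution g (fun x => φ (r • x)) (ContinuousLinearMap.mul ℂ ℂ) volume

theorem continuous_dilatedConvolution {d : ℕ} {g φ : EuclideanSpace ℝ (Fin d) → ℂ}
    (hg : Integrable g) (hφ : Continuous φ) (hφs : HasCompactSupport φ) {r : ℝ} (hr : 0 < r) :
    Continuous (dilatedConvolution g φ r) :=
  (hφs.comp_smul hr.ne').continuous_convolution_right _ hg.locallyIntegrable
    (hφ.comp (continuous_const_smul r))

theorem hasCompactSupport_dilatedConvolution {d : ℕ} {g φ : EuclideanSpace ℝ (Fin d) → ℂ}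
    (hgs : HasCompactSupport g) (hφs : HasCompactSupport φ) {r : ℝ} (hr : 0 < r) :
    HasCompactSupport (dilatedConvolution g φ r) :=
  hgs.convolution _ (hφs.comp_smul hr.ne')

theorem norm_fourier_dilatedConvolution {d : ℕ} {g φ : EuclideanSpace ℝ (Fin d) → ℂ}
    (hg : Integrable g) (hφ : Integrable φ) {r : ℝ} (hr : 0 < r)
    (ξ : EuclideanSpace ℝ (Fin d)) :
    ‖𝓕 (dilatedConvolution g φ r) ξ‖ = (r ^ d)⁻¹ * ‖𝓕 φ (r⁻¹ • ξ)‖ * ‖𝓕 g ξ‖ := by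
  rw [dilatedConvolution, Real.fourier_mul_convolution_eq hg (hφ.comp_smul hr.ne'), norm_mul,
    fourier_comp_smul_eq φ hr, norm_smul, Real.norm_of_nonneg (by positivity), mul_comm]

/-- The value at `x` averages `φ(r(x - t))` over `t` in the unit ball, where `‖r(x - t)‖ ≤ r(‖x‖ +
1) ≤ 1`. -/
theorem dilatedConvolution_eq_one {d : ℕ} {g φ : EuclideanSpace ℝ (Fin d) → ℂ}
    (hg1 : ∫ x, g x = 1) (hg : ∀ x, 1 ≤ ‖x‖ → g x = 0) (hφ : ∀ x, ‖x‖ ≤ 1 → φ x = 1)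
    {r : ℝ} (hr : 0 < r) {x : EuclideanSpace ℝ (Fin d)} (hx : r * (‖x‖ + 1) ≤ 1) :
    dilatedConvolution g φ r x = 1 := by
  rw [← hg1]
  refine integral_congr_ae (Eventually.of_forall fun t => ?_)
  rcases le_total 1 ‖t‖ with ht | ht
  · simp [hg t ht]
  · have : φ (r • (x - t)) = 1 := hφ _ <| by
      rw [norm_smul, Real.norm_of_nonneg hr.le]
      refine le_trans ?_ hx
      have := norm_sub_le x t
      gcongr
      linarith
    simp [this]

/-- A continuous bump function of integral one which vanishes outside the unit ball. -/
theorem exists_normalized_bump (d : ℕ) :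
    ∃ g : EuclideanSpace ℝ (Fin d) → ℂ, Continuous g ∧ HasCompactSupport g ∧ ∫ x, g x = 1 ∧
      (∀ x, 1 ≤ ‖x‖ → g x = 0) ∧ ∀ ξ, ‖𝓕 g ξ‖ ≤ 1 := by
  obtain ⟨b, hb⟩ : ∃ b : ContDiffBump (0 : EuclideanSpace ℝ (Fin d)), b.rOut = 1 :=
    ⟨⟨1 / 2, 1, by norm_num, by norm_num⟩, rfl⟩
  refine ⟨fun x => ((b.normed volume x : ℝ) : ℂ),
    Complex.continuous_ofReal.comp b.continuous_normed,
    b.hasCompactSupport_normed.comp_left Complex.ofReal_zero, ?_, fun x hx => ?_, fun ξ => ?_⟩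
  · rw [integral_complex_ofReal, b.integral_normed, Complex.ofReal_one]
  · have : b.normed volume x = 0 := by
      rw [← Function.notMem_support, b.support_normed_eq, hb, mem_ball_zero_iff, not_lt]
      exact hx
    simp only [this, Complex.ofReal_zero]
  · refine (VectorFourier.norm_fourierIntegral_le_integral_norm _ _ _ _ _).trans (le_of_eq ?_)
    rw [← b.integral_normed (μ := volume)]
    congr 1
    ext x
    rw [Complex.norm_real, Real.norm_of_nonneg (b.nonneg_normed x)]

/-- A smooth bump function which equals one on the unit ball. -/
theorem exists_smooth_bump (d : ℕ) :
    ∃ φ : EuclideanSpace ℝ (Fin d) → ℂ, ContDiff ℝ (⊤ : ℕ∞) φ ∧ HasCompactSupport φ ∧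
      ∀ x, ‖x‖ ≤ 1 → φ x = 1 := by
  obtain ⟨c, hc⟩ : ∃ c : ContDiffBump (0 : EuclideanSpace ℝ (Fin d)), c.rIn = 1 :=
    ⟨⟨1, 2, by norm_num, by norm_num⟩, rfl⟩
  refine ⟨fun x => ((c x : ℝ) : ℂ), Complex.ofRealCLM.contDiff.comp c.contDiff,
    c.hasCompactSupport.comp_left Complex.ofReal_zero, fun x hx => ?_⟩
  have : c x = 1 := c.one_of_mem_closedBall (by rwa [hc, mem_closedBall_zero_iff])
  simp only [this, Complex.ofReal_one]

/-- Cutoff functions which equal `1` on large balls, with Fourier transforms concentrated near the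
origin. -/
theorem exists_cutoff (d N : ℕ) :
    ∃ g : EuclideanSpace ℝ (Fin d) → ℂ, Continuous g ∧ HasCompactSupport g ∧ ∃ K : ℝ, 0 < K ∧
      ∀ r : ℝ, 0 < r → ∃ f : EuclideanSpace ℝ (Fin d) → ℂ,
        Continuous f ∧ HasCompactSupport f ∧ (∀ x, r * (‖x‖ + 1) ≤ 1 → f x = 1) ∧
        (∀ ξ, ‖𝓕 f ξ‖ ≤ K * (r ^ d)⁻¹) ∧
        ∀ ξ, ‖ξ‖ ^ N * ‖𝓕 f ξ‖ ≤ K * (r ^ d)⁻¹ * r ^ N * ‖𝓕 g ξ‖ := by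
  obtain ⟨g, hg, hgs, hg1, hg0, hgF⟩ := exists_normalized_bump d
  obtain ⟨φ, hφ, hφs, hφ1⟩ := exists_smooth_bump d
  have hgi : Integrable g := hg.integrable_of_hasCompactSupport hgs
  have hφi : Integrable φ := hφ.continuous.integrable_of_hasCompactSupport hφs
  -- Exponent `0` gives the uniform bound and exponent `N` the decay; `K₀ + K₁` serves for both.
  obtain ⟨K₀, hK₀, h₀⟩ := exists_norm_pow_mul_fourier_le hφs hφ 0
  obtain ⟨K₁, hK₁, h₁⟩ := exists_norm_pow_mul_fourier_le hφs hφ N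
  refine ⟨g, hg, hgs, K₀ + K₁, by positivity, fun r hr =>
    ⟨dilatedConvolution g φ r, continuous_dilatedConvolution hgi hφ.continuous hφs hr,
      hasCompactSupport_dilatedConvolution hgs hφs hr,
      fun x hx => dilatedConvolution_eq_one hg1 hg0 hφ1 hr hx, fun ξ => ?_, fun ξ => ?_⟩⟩
  · rw [norm_fourier_dilatedConvolution hgi hφi hr, mul_comm (K₀ + K₁), mul_assoc]
    gcongr
    have := h₀ (r⁻¹ • ξ)
    rw [pow_zero, one_mul] at this
    calc _ ≤ K₀ * 1 := mul_le_mul this (hgF ξ) (norm_nonneg _) hK₀.le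
      _ ≤ K₀ + K₁ := by linarith
  · rw [norm_fourier_dilatedConvolution hgi hφi hr]
    -- Decay of `𝓕 φ` at the rescaled point `r⁻¹ • ξ` produces the gain `r ^ N`.
    have := h₁ (r⁻¹ • ξ)
    rw [norm_smul, norm_inv, Real.norm_of_nonneg hr.le, mul_pow, inv_pow, mul_assoc,
      inv_mul_le_iff₀ (by positivity)] at this
    calc _ = (r ^ d)⁻¹ * (‖ξ‖ ^ N * ‖𝓕 φ (r⁻¹ • ξ)‖) * ‖𝓕 g ξ‖ := by ring
      _ ≤ (r ^ d)⁻¹ * (r ^ N * (K₀ + K₁)) * ‖𝓕 g ξ‖ := by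
        refine mul_le_mul_of_nonneg_right (mul_le_mul_of_nonneg_left ?_ (by positivity))
          (norm_nonneg _)
        exact this.trans (mul_le_mul_of_nonneg_left (by linarith) (by positivity))
      _ = _ := by ring

/-! ### Smallness in `L²(ν)` from decay at the origin -/

/-- If `u` is bounded by `A` on a ball and by `D * v` outside, its second moment is controlled by
the mass of the ball and by the second moment of `v`. -/
theorem integral_sq_le_ball_add {E : Type*} [NormedAddCommGroup E] [MeasurableSpace E]
    [OpensMeasurableSpace E] {ν : Measure E} {u v : E → ℝ} {A D ε : ℝ}
    (hu : ∀ x, 0 ≤ u x) (hui : Integrable (fun x => u x ^ 2) ν)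
    (hvi : Integrable (fun x => v x ^ 2) ν)
    (hν : ν (Metric.ball 0 ε) ≠ ∞) (hA : ∀ x, u x ≤ A) (hD : ∀ x, ε ≤ ‖x‖ → u x ≤ D * v x) :
    ∫ x, u x ^ 2 ∂ν ≤ A ^ 2 * ν.real (Metric.ball 0 ε) + D ^ 2 * ∫ x, v x ^ 2 ∂ν := by
  have hi : Integrable ((Metric.ball (0 : E) ε).indicator (fun _ => A ^ 2)) ν :=
    (integrable_indicator_iff Metric.isOpen_ball.measurableSet).2
      (integrableOn_const hν)
  calc ∫ x, u x ^ 2 ∂ν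
      ≤ ∫ x, ((Metric.ball (0 : E) ε).indicator (fun _ => A ^ 2) x + D ^ 2 * v x ^ 2) ∂ν := by
        refine integral_mono hui (hi.add (hvi.const_mul _)) fun x => ?_
        by_cases hx : x ∈ Metric.ball (0 : E) ε
        · simp only [Set.indicator_of_mem hx]
          have := pow_le_pow_left₀ (hu x) (hA x) 2
          nlinarith [mul_nonneg (sq_nonneg D) (sq_nonneg (v x))]
        · simp only [Set.indicator_of_notMem hx, zero_add]
          rw [← mul_pow]
          exact pow_le_pow_left₀ (hu x) (hD x (by simpa using hx)) 2
    _ = _ := by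
        rw [integral_add hi (hvi.const_mul _), integral_const_mul,
          integral_indicator Metric.isOpen_ball.measurableSet, setIntegral_const, smul_eq_mul,
          mul_comm]

/-- Under fast decay of `ν` at the origin along a sequence of radii, there are cutoff functions
exhausting the space whose Fourier transforms tend to zero in `L²(ν)`. -/
theorem exists_cutoff_seq_tendsto {d : ℕ} {ν : Measure (EuclideanSpace ℝ (Fin d))}
    (hν : ∀ f : EuclideanSpace ℝ (Fin d) → ℂ, Continuous f → HasCompactSupport f →
      Integrable (fun ξ => ‖𝓕 f ξ‖ ^ 2) ν)
    {ε : ℕ → ℝ} (hε : ∀ n, 0 < ε n) (hε0 : Tendsto ε atTop (𝓝 0)) {δ : ℝ} (hδ : 0 < δ)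
    {C : ℝ} (hC : 0 < C)
    (hdecay : ∀ n, ν (Metric.ball 0 (ε n)) ≤ ENNReal.ofReal (C * ε n ^ (2 * (d : ℝ) + δ))) :
    ∃ f : ℕ → EuclideanSpace ℝ (Fin d) → ℂ,
      (∀ n, Continuous (f n) ∧ HasCompactSupport (f n)) ∧
      (∀ R : ℝ, ∀ᶠ n in atTop, ∀ x, ‖x‖ ≤ R → f n x = 1) ∧
      Tendsto (fun n => ∫ ξ, ‖𝓕 (f n) ξ‖ ^ 2 ∂ν) atTop (𝓝 0) := by
  -- This makes the exponent `δ - 2dγ` of the ball term positive.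
  obtain ⟨γ, hγ, hγδ⟩ : ∃ γ : ℝ, 0 < γ ∧ 2 * d * γ < δ := by
    refine ⟨δ / (2 * d + 1), by positivity, ?_⟩
    rw [mul_div_assoc', div_lt_iff₀ (by positivity)]
    nlinarith
  -- This makes the exponent `2(Nγ - d(1 + γ))` of the outer term positive.
  obtain ⟨N, hN⟩ : ∃ N : ℕ, d * (1 + γ) < N * γ := by
    obtain ⟨N, hN⟩ := exists_nat_gt (d * (1 + γ) / γ)
    exact ⟨N, (div_lt_iff₀ hγ).1 hN⟩
  obtain ⟨g, hg, hgs, K, hK, H⟩ := exists_cutoff d N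
  choose f hf hfs hf1 hfK hfN using fun n => H (ε n ^ (1 + γ)) (Real.rpow_pos_of_pos (hε n) _)
  refine ⟨f, fun n => ⟨hf n, hfs n⟩, fun R => ?_, ?_⟩
  · have h0 : Tendsto (fun n => ε n ^ (1 + γ) * (R + 1)) atTop (𝓝 0) := by
      simpa [Real.zero_rpow (by positivity : 1 + γ ≠ 0)] using
        (hε0.rpow_const (p := 1 + γ) (Or.inr (by positivity))).mul_const (R + 1)
    filter_upwards [h0.eventually_le_const one_pos] with n hn x hx
    refine hf1 n x (le_trans ?_ hn)
    have := Real.rpow_pos_of_pos (hε n) (1 + γ)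
    gcongr
  set I := ∫ ξ, ‖𝓕 g ξ‖ ^ 2 ∂ν
  have hlim : Tendsto (fun n => K ^ 2 * C * ε n ^ (δ - 2 * d * γ) +
      K ^ 2 * I * ε n ^ (2 * (N * γ - d * (1 + γ)))) atTop (𝓝 0) := by
    have h1 := hε0.rpow_const (p := δ - 2 * d * γ) (Or.inr (by linarith))
    have h2 := hε0.rpow_const (p := 2 * (N * γ - d * (1 + γ))) (Or.inr (by linarith))
    rw [Real.zero_rpow (by linarith)] at h1 h2
    simpa using (h1.const_mul (K ^ 2 * C)).add (h2.const_mul (K ^ 2 * I))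
  refine squeeze_zero (fun n => integral_nonneg fun _ => sq_nonneg _) (fun n => ?_) hlim
  have hεn := hε n
  have hrp : ∀ k : ℕ, (ε n ^ (1 + γ)) ^ k = ε n ^ ((1 + γ) * k) := fun k => by
    rw [Real.rpow_mul_natCast hεn.le]
  have hball : ν.real (Metric.ball 0 (ε n)) ≤ C * ε n ^ (2 * (d : ℝ) + δ) :=
    ENNReal.toReal_le_of_le_ofReal (by positivity) (hdecay n)
  -- With `r = ε n ^ (1 + γ)`, `A` is `K r⁻ᵈ` and `D` is `K r⁻ᵈ (r / ε n) ^ N`, the latter from `‖ξ‖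
  -- ≥ ε n`.
  refine (integral_sq_le_ball_add (A := K * ((ε n ^ (1 + γ)) ^ d)⁻¹)
    (D := K * ((ε n ^ (1 + γ)) ^ d)⁻¹ * (ε n ^ (1 + γ)) ^ N / ε n ^ N)
    (fun _ => norm_nonneg _) (hν _ (hf n) (hfs n)) (hν g hg hgs)
    ((hdecay n).trans_lt ENNReal.ofReal_lt_top).ne (hfK n) fun ξ hξ => ?_).trans ?_
  · rw [div_mul_eq_mul_div, le_div_iff₀ (by positivity), mul_comm]
    refine le_trans ?_ (hfN n ξ)
    gcongr
  · refine add_le_add ?_ (le_of_eq ?_)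
    · refine (mul_le_mul_of_nonneg_left hball (sq_nonneg _)).trans (le_of_eq ?_)
      rw [mul_pow, inv_pow, ← pow_mul, hrp, ← Real.rpow_neg hεn.le, mul_mul_mul_comm,
        ← Real.rpow_add hεn]
      congr 2
      push_cast
      ring
    · rw [mul_div_assoc, mul_pow, mul_pow, inv_pow, div_pow, ← pow_mul, ← pow_mul, ← pow_mul, hrp,
        hrp, ← Real.rpow_neg hεn.le, ← Real.rpow_natCast (ε n) (N * 2), ← Real.rpow_sub hεn,
        mul_assoc (K ^ 2), ← Real.rpow_add hεn, mul_right_comm]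
      congr 2
      push_cast
      ring

/-! ### From vanishing variance to number rigidity -/

/-- A sequence whose second moments tend to zero has a subsequence converging to zero almost
everywhere. -/
theorem exists_subseq_tendsto_ae_of_integral_sq {Ω E : Type*} [MeasurableSpace Ω]
    [NormedAddCommGroup E] {P : Measure Ω} {Y : ℕ → Ω → E} (hY : ∀ n, MemLp (Y n) 2 P)
    (h : Tendsto (fun n => ∫ ω, ‖Y n ω‖ ^ 2 ∂P) atTop (𝓝 0)) :
    ∃ ns : ℕ → ℕ, StrictMono ns ∧ ∀ᵐ ω ∂P, Tendsto (fun k => Y (ns k) ω) atTop (𝓝 0) := by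
  have hi : ∀ n, Integrable (fun ω => ‖Y n ω‖ ^ 2) P := fun n =>
    (memLp_two_iff_integrable_sq_norm (hY n).1).1 (hY n)
  -- The squares tend to zero in `L¹`, hence in measure; square roots are taken after passing to the
  -- subsequence.
  have hm : TendstoInMeasure P (fun n ω => ‖Y n ω‖ ^ 2) atTop (fun _ => (0 : ℝ)) := by
    refine tendstoInMeasure_of_tendsto_eLpNorm one_ne_zero (fun n => (hi n).1)
      aestronglyMeasurable_const ?_
    have : ∀ n, eLpNorm ((fun ω => ‖Y n ω‖ ^ 2) - fun _ => (0 : ℝ)) 1 P =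
        ENNReal.ofReal (∫ ω, ‖Y n ω‖ ^ 2 ∂P) := fun n => by
      rw [eLpNorm_one_eq_lintegral_enorm,
        ← ofReal_integral_norm_eq_lintegral_enorm (by simpa [Pi.sub_def] using hi n)]
      simp
    simp_rw [this]
    simpa using ENNReal.tendsto_ofReal h
  obtain ⟨ns, hns, hae⟩ := hm.exists_seq_tendsto_ae
  refine ⟨ns, hns, hae.mono fun ω hω => ?_⟩
  rw [tendsto_zero_iff_norm_tendsto_zero]
  simpa [Real.sqrt_sq (norm_nonneg _)] using hω.sqrt

namespace SignedRadonMeasure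

theorem integral_eq_restrict_add_restrict_compl {d : ℕ} (μ : SignedRadonMeasure d)
    {f : EuclideanSpace ℝ (Fin d) → ℂ} (hf : Continuous f) (hfs : HasCompactSupport f)
    {B : Set (EuclideanSpace ℝ (Fin d))} (hB : MeasurableSet B) :
    μ.integral f = (μ.restrict B).integral f + (μ.restrict Bᶜ).integral f := by
  have := μ.pos_locallyFinite
  have := μ.neg_locallyFinite
  have h1 := integral_add_compl hB (hf.integrable_of_hasCompactSupport hfs (μ := μ.pos))
  have h2 := integral_add_compl hB (hf.integrable_of_hasCompactSupport hfs (μ := μ.neg))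
  simp only [integral, restrict, ← h1, ← h2]
  ring

/-- This links the complex statistics of the cutoffs to the real mass of `B` appearing in
`IsNumberRigid`. -/
theorem integral_restrict_of_eqOn_one {d : ℕ} (μ : SignedRadonMeasure d)
    {f : EuclideanSpace ℝ (Fin d) → ℂ} {B : Set (EuclideanSpace ℝ (Fin d))} (hB : MeasurableSet B)
    (hf : ∀ x ∈ B, f x = 1) :
    (μ.restrict B).integral f = (((μ.restrict B).integral fun _ => (1 : ℝ) : ℝ) : ℂ) := by
  simp only [integral, restrict]
  rw [setIntegral_congr_fun hB hf, setIntegral_congr_fun hB hf]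
  simp

end SignedRadonMeasure

/-- A random measure is number rigid if there are cutoff functions exhausting the space with
linear statistics of vanishing variance. -/
theorem isNumberRigid_of_tendsto_variance {d : ℕ} {Ω : Type*} [MeasurableSpace Ω]
    {P : Measure Ω} [IsProbabilityMeasure P] {p : Ω → SignedRadonMeasure d}
    {f : ℕ → EuclideanSpace ℝ (Fin d) → ℂ}
    (hf : ∀ n, Continuous (f n) ∧ HasCompactSupport (f n))
    (hf1 : ∀ R : ℝ, ∀ᶠ n in atTop, ∀ x, ‖x‖ ≤ R → f n x = 1)
    (hL2 : ∀ n, MemLp (fun ω => (p ω).integral (f n)) 2 P)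
    (hvar : Tendsto (fun n => linearStatisticVariance P p (f n)) atTop (𝓝 0)) :
    IsNumberRigid P p := by
  obtain ⟨ns, hns, hae⟩ := exists_subseq_tendsto_ae_of_integral_sq
    (fun n => (hL2 n).sub (memLp_const (∫ ω', (p ω').integral (f n) ∂P))) hvar
  intro B hB hBm
  -- The conull set is the set of convergence, the same for every `B`.
  refine ⟨_, hae, fun ω hω ω' hω' heq => ?_⟩
  obtain ⟨R, hR⟩ := hB.exists_norm_le
  have hlim := Tendsto.sub hω hω'
  rw [sub_zero] at hlim
  -- Once the cutoff is `1` on `B`, the expectations and the parts outside `B` cancel, so the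
  -- difference no longer depends on `k`.
  have hconst : ∀ᶠ k in atTop, (((((p ω).restrict B).integral fun _ => (1 : ℝ)) -
      ((p ω').restrict B).integral fun _ => (1 : ℝ) : ℝ) : ℂ) =
      ((p ω).integral (f (ns k)) - ∫ ω', (p ω').integral (f (ns k)) ∂P) -
        ((p ω').integral (f (ns k)) - ∫ ω', (p ω').integral (f (ns k)) ∂P) := by
    filter_upwards [hns.tendsto_atTop.eventually (hf1 R)] with k hk
    have h1 : ∀ x ∈ B, f (ns k) x = 1 := fun x hx => hk x (hR x hx)
    rw [(p ω).integral_eq_restrict_add_restrict_compl (hf _).1 (hf _).2 hBm,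
      (p ω').integral_eq_restrict_add_restrict_compl (hf _).1 (hf _).2 hBm, heq,
      SignedRadonMeasure.integral_restrict_of_eqOn_one _ hBm h1,
      SignedRadonMeasure.integral_restrict_of_eqOn_one _ hBm h1]
    push_cast
    ring
  have h0 := tendsto_nhds_unique (tendsto_const_nhds.congr' hconst) hlim
  exact sub_eq_zero.1 (Complex.ofReal_eq_zero.1 h0)

theorem mainTheorem7 {d : ℕ} {Ω : Type*} [MeasurableSpace Ω]
    [AddAction (EuclideanSpace ℝ (Fin d)) Ω] (P : Measure Ω) [IsProbabilityMeasure P]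
    (p : Ω → SignedRadonMeasure d) (hp : IsInvariantRandomMeasure P p)
    (hp2 : IsLocallySquareIntegrable P p)
    (ν : Measure (EuclideanSpace ℝ (Fin d))) (hν : IsCenteredDiffraction P p ν)
    (ε : ℕ → ℝ) (hε : ∀ n, 0 < ε n) (hε0 : Tendsto ε atTop (𝓝 0))
    (δ : ℝ) (hδ : 0 < δ)
    (hdecay : ∃ C : ℝ, 0 < C ∧
      ∀ n, ν (Metric.ball 0 (ε n)) ≤ ENNReal.ofReal (C * ε n ^ (2 * (d : ℝ) + δ))) :
    IsNumberRigid P p := by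
  obtain ⟨η, hη, -, hFT⟩ := hν
  obtain ⟨C, hC, hdecay⟩ := hdecay
  obtain ⟨f, hf, hf1, hlim⟩ := exists_cutoff_seq_tendsto (fun g hg hgs => (hFT g hg hgs).1)
    hε hε0 hδ hC hdecay
  have hbcs : ∀ n, IsBoundedCompactlySupported (f n) := fun n =>
    ⟨(hf n).1.measurable, (hf n).1.bounded_above_of_compact_support (hf n).2, (hf n).2⟩
  refine isNumberRigid_of_tendsto_variance hf hf1 (fun n => (hη _ (hbcs n)).1) ?_
  refine hlim.congr fun n => ?_
  exact Complex.ofReal_injective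
    ((hFT _ (hf n).1 (hf n).2).2.trans (hη _ (hbcs n)).2)
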